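/- Conventions. Everything is over $\mathbb R$ and in the super ($\mathbb Z/2$-graded) sense; $\tilde a$ is the parity of $a$ and $(-1)^a$ means $(-1)^{\tilde a}$. A symplectic $2$-manifold $\mathcal M$ is a supermanifold (with underlying smooth manifold $X$) with a grading of its functions by weight, having local coordinates of weights $0,1,2$ and functions polynomial in the coordinates of positive weight, together with a weight $2$ even symplectic structure, given by its Poisson bracket: an even, non-degenerate Poisson bracket $[-,-]$ of weight $-2$ on functions. Let $\mathcal A=\bigoplus_{k\ge 0}\mathcal A^k$ be its algebra of functions, and let $E$ be the corresponding pseudo-Euclidean vector bundle: its space of sections $\Gamma(E)$ comes with an odd isomorphism $\chi:\Gamma(E)\to\mathcal A^1$, $u\mapsto\chi_u$ (with $\chi_{fu}=(-1)^f f\chi_u$ for $f\in\mathcal A^0$), and with the bilinear form $g(u,v)=(-1)^u[\chi_u,\chi_v]$. Let $P:\mathcal A\to\mathcal A^0\oplus\mathcal A^1$ be the projector onto weights $0$ and $1$. For a linear map $D:\mathcal A\to\mathcal A$ the $k$th derived Dorfman bracket generated by $D$, $k\ge1$, is the multilinear operation $d_k^D:\Gamma(E)^{\times k}\to\Gamma(E)$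 given on homogeneous sections by $$\chi\big(d^D_k(u_1,\dots,u_k)\big)=(-1)^{(k-1)u_1+(k-2)u_2+\cdots+u_{k-1}}\Big(P[\cdots[D\chi_{u_1},\chi_{u_2}],\dots,\chi_{u_k}]-[P[\cdots[D\chi_{u_1},\chi_{u_2}],\dots,\chi_{u_{k-1}}],\chi_{u_k}]\Big),$$ where for $k=1$ the right-hand side is $PD\chi_{u_1}$. Multilinear operations $l_k$, $k\ge 1$, of parity $k \bmod 2$ on a super vector space $V$ form a homotopy Loday algebra if for all $n\ge1$ and all homogeneous $v_1,\dots,v_n$ the expression $$J_n(v_1,\dots,v_n)=\sum_{i+j=n+1}\ \sum_{k=j}^{n}\ \sum_{\sigma\in Sh(k-j,j-1)}K(\sigma)(-1)^{(n-k+1)(j-1)}(-1)^{j(v_{\sigma(1)}+\cdots+v_{\sigma(k-j)})}\,l_i\big(v_{\sigma(1)},\dots,v_{\sigma(k-j)},l_j(v_{\sigma(k-j+1)},\dots,v_{\sigma(k-1)},v_k),v_{k+1},\dots,v_n\big)$$ vanishes; here $i,j\ge1$, $Sh(k-j,j-1)$ is the set of $(k-j,j-1)$-unshuffles of $\{1,\dots,k-1\}$,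 and $K(\sigma)$ is the product of the sign of $\sigma$ and the Koszul sign of permuting $v_1,\dots,v_{k-1}$. Theorem. Let $\theta\in\mathcal A$ be odd with $P\theta=0$ and let $Q=[\theta,-]$. Then the formula above defines brackets $d_k=d_k^Q$ and $d_k^{Q^2}$ for all $k\ge1$ (that is, for $D=Q$ and for $D=Q^2$ its right-hand side lies in $\mathcal A^1$), and for all $n\ge1$ and all homogeneous $u_1,\dots,u_n\in\Gamma(E)$ the expression $J_n$ formed with $l_k=d_k$ satisfies $$J_n(u_1,\dots,u_n)=(-1)^{n+1}\,d_n^{Q^2}(u_1,\dots,u_n).$$ In particular, if $Q^2=0$, then the operations $d_1,d_2,d_3,\dots$ make $\Gamma(E)$ a homotopy Loday algebra. The binary operation is the Dorfman bracket generated by the weight $3$ component $\theta_3$ of $\theta$: $\chi(d_2(u,v))=(-1)^u[[\theta_3,\chi_u],\chi_v]$ for $u,v\in\Gamma(E)$ with $u$ homogeneous. -/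

import Mathlib

open scoped Manifold ContDiff
open TopologicalSpace

namespace HigherDorfman

universe u v w

/-- The sign `(-1)^s` of a parity `s`. -/
def sgn (s : ZMod 2) : ℝ := (-1) ^ s.val

/-! ### Weighted Poisson superalgebras -/

section Algebra

variable {A : Type v} [Ring A] [Algebra ℝ A]

/-- A weight grading and a parity grading on `A` that are compatible with each other and for
which `A` is commutative in the super sense. -/
structure IsWeightedSuperalgebra (wt : ℕ → Submodule ℝ A) [GradedAlgebra wt]
    (par : ZMod 2 → Submodule ℝ A) [GradedAlgebra par] : Prop where
  proj_mem_par : ∀ (k : ℕ) (s : ZMod 2) (f : A), f ∈ par s → GradedAlgebra.proj wt k f ∈ par s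
  super_comm : ∀ (s t : ZMod 2) (f g : A), f ∈ par s → g ∈ par t → f * g = sgn (s * t) • (g * f)

/-- An even Poisson bracket of weight `-2`. -/
structure IsWeightTwoPoisson (wt : ℕ → Submodule ℝ A) (par : ZMod 2 → Submodule ℝ A)
    (br : A →ₗ[ℝ] A →ₗ[ℝ] A) : Prop where
  par_mem : ∀ (s t : ZMod 2) (f g : A), f ∈ par s → g ∈ par t → br f g ∈ par (s + t)
  wt_mem : ∀ (k l m : ℕ) (f g : A), f ∈ wt k → g ∈ wt l → m + 2 = k + l → br f g ∈ wt m
  wt_neg : ∀ (k l : ℕ) (f g : A), f ∈ wt k → g ∈ wt l → k + l < 2 → br f g = 0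
  super_skew : ∀ (s t : ZMod 2) (f g : A), f ∈ par s → g ∈ par t →
    br f g = -(sgn (s * t) • br g f)
  leibniz : ∀ (s t : ZMod 2) (f g h : A), f ∈ par s → g ∈ par t →
    br f (g * h) = br f g * h + sgn (s * t) • (g * br f h)
  jacobi : ∀ (s t : ZMod 2) (f g h : A), f ∈ par s → g ∈ par t →
    br f (br g h) = br (br f g) h + sgn (s * t) • br g (br f h)

/-- The projector onto weights `0` and `1`. -/
noncomputable def projP (wt : ℕ → Submodule ℝ A) [GradedAlgebra wt] : A →ₗ[ℝ] A :=
  GradedAlgebra.proj wt 0 + GradedAlgebra.proj wt 1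

/-- The component of weight `1`, as an element of that component. -/
noncomputable def toWeightOne (wt : ℕ → Submodule ℝ A) [GradedAlgebra wt] : A →ₗ[ℝ] wt 1 :=
  (DirectSum.component ℝ ℕ (fun k => wt k) 1) ∘ₗ
    (DirectSum.decomposeLinearEquiv wt).toLinearMap

/-- `(a₁, …, aₖ₊₁) ↦ [⋯[D a₁, a₂], …, aₖ₊₁]`. -/
noncomputable def nested (br : A →ₗ[ℝ] A →ₗ[ℝ] A) (D : A →ₗ[ℝ] A) :
    (k : ℕ) → MultilinearMap ℝ (fun _ : Fin (k + 1) => A) A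
  | 0 => MultilinearMap.ofSubsingleton ℝ A A (0 : Fin 1) D
  | k + 1 => (br.compMultilinearMap (nested br D k)).uncurryRight

/-- `(a₁, …, aₖ₊₁) ↦ P[⋯[D a₁, a₂], …, aₖ₊₁] - [P[⋯[D a₁, a₂], …, aₖ], aₖ₊₁]`, which is
`P (D a₁)` for a single argument. -/
noncomputable def derivedForm (wt : ℕ → Submodule ℝ A) [GradedAlgebra wt]
    (br : A →ₗ[ℝ] A →ₗ[ℝ] A) (D : A →ₗ[ℝ] A) :
    (k : ℕ) → MultilinearMap ℝ (fun _ : Fin (k + 1) => A) A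
  | 0 => (projP wt).compMultilinearMap (nested br D 0)
  | k + 1 => (projP wt).compMultilinearMap (nested br D (k + 1)) -
      ((br ∘ₗ projP wt).compMultilinearMap (nested br D k)).uncurryRight

end Algebra

/-! ### Homotopy Loday algebras -/

section Loday

variable {V : Type w} [AddCommGroup V] [Module ℝ V]

/-- Apply the operation of the right arity to a list of arguments. -/
def apply (l : (k : ℕ) → MultilinearMap ℝ (fun _ : Fin k => V) V) (L : List V) : V :=
  l L.length L.get

/-- The `(a, m - a)`-unshuffles. -/
def unshuffles (a m : ℕ) : Finset (Equiv.Perm (Fin m)) :=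
  {σ | ∀ x y : Fin m, x < y → ((y : ℕ) < a ∨ a ≤ (x : ℕ)) → σ x < σ y}

/-- The Koszul sign `κ(σ)` of `v₁ ⋯ vₘ = κ(σ) v_{σ(1)} ⋯ v_{σ(m)}`, for `vₓ` of parity `q x`. -/
def koszulSign {m : ℕ} (q : Fin m → ZMod 2) (σ : Equiv.Perm (Fin m)) : ℝ :=
  ∏ x : Fin m, ∏ y : Fin m, if x < y ∧ σ y < σ x then sgn (q (σ x) * q (σ y)) else 1

/-- The left-hand side `Jₙ(v₁, …, vₙ)` of the `n`th homotopy Loday identity, for homogeneous `vₓ`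
of parity `q x`. In the usual numbering from `1`, the summation variable `c` stands for `k - 1`
(so `v c` is `vₖ`), `b` for `j - 1` and `i = n + 1 - j`; the sign is
`sgn(σ) κ(σ) (-1)^{(n-k+1)(j-1)} (-1)^{j(v_{σ(1)} + ⋯ + v_{σ(k-j)})}`. -/
def lodayJ (l : (k : ℕ) → MultilinearMap ℝ (fun _ : Fin k => V) V) {n : ℕ}
    (q : Fin n → ZMod 2) (v : Fin n → V) : V :=
  ∑ c : Fin n, ∑ b ∈ Finset.range ((c : ℕ) + 1), ∑ σ ∈ unshuffles ((c : ℕ) - b) (c : ℕ),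
    (((Equiv.Perm.sign σ : ℤ) : ℝ) *
      koszulSign (fun x : Fin c => q (x.castLE c.isLt.le)) σ *
      (-1) ^ ((n - (c : ℕ)) * b) *
      sgn (((b + 1 : ℕ) : ZMod 2) *
        ∑ x : Fin c, if (x : ℕ) < (c : ℕ) - b then q ((σ x).castLE c.isLt.le) else 0)) •
    apply l
      ((List.ofFn fun x : Fin c => v ((σ x).castLE c.isLt.le)).take ((c : ℕ) - b) ++
        [apply l ((List.ofFn fun x : Fin c => v ((σ x).castLE c.isLt.le)).drop ((c : ℕ) - b) ++
          [v c])] ++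
        (List.ofFn v).drop ((c : ℕ) + 1))

/-- Operations `l₁, l₂, …` on the super vector space `V` form a homotopy Loday algebra: `lₖ` has
parity `k mod 2`, and all the homotopy Loday identities hold. -/
structure IsHomotopyLoday (par : ZMod 2 → Submodule ℝ V)
    (l : (k : ℕ) → MultilinearMap ℝ (fun _ : Fin k => V) V) : Prop where
  parity : ∀ (k : ℕ), 1 ≤ k → ∀ (q : Fin k → ZMod 2) (v : Fin k → V), (∀ x, v x ∈ par (q x)) →
    l k v ∈ par ((k : ZMod 2) + ∑ x, q x)
  identity : ∀ (n : ℕ), 1 ≤ n → ∀ (q : Fin n → ZMod 2) (v : Fin n → V), (∀ x, v x ∈ par (q x)) →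
    lodayJ l q v = 0

/-- The linear involution equal to `(-1)^s` on vectors of parity `s`. -/
noncomputable def parityInvolution (par : ZMod 2 → Submodule ℝ V) [DirectSum.Decomposition par] :
    V →ₗ[ℝ] V :=
  ∑ s : ZMod 2, sgn s • ((par s).subtype ∘ₗ (DirectSum.component ℝ (ZMod 2) (fun t => par t) s) ∘ₗ
    (DirectSum.decomposeLinearEquiv par).toLinearMap)

end Loday

/-! ### Symplectic 2-manifolds -/

/-- A presheaf of weighted superalgebras on `X` whose components of each weight are sheaves. -/
structure WeightedSheaf (X : Type u) [TopologicalSpace X] where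
  F : Opens X → Type v
  [ring : ∀ U, Ring (F U)]
  [algebra : ∀ U, Algebra ℝ (F U)]
  wt : ∀ U, ℕ → Submodule ℝ (F U)
  [wtGraded : ∀ U, GradedAlgebra (wt U)]
  par : ∀ U, ZMod 2 → Submodule ℝ (F U)
  [parGraded : ∀ U, GradedAlgebra (par U)]
  super : ∀ U, IsWeightedSuperalgebra (wt U) (par U)
  res : ∀ {U W : Opens X}, W ≤ U → F U →ₐ[ℝ] F W
  res_self : ∀ (U : Opens X) (f : F U), res le_rfl f = f
  res_res : ∀ {U W W' : Opens X} (h : W ≤ U) (h' : W' ≤ W) (f : F U),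
    res h' (res h f) = res (h'.trans h) f
  res_wt : ∀ {U W : Opens X} (h : W ≤ U) (k : ℕ) (f : F U), f ∈ wt U k → res h f ∈ wt W k
  res_par : ∀ {U W : Opens X} (h : W ≤ U) (s : ZMod 2) (f : F U), f ∈ par U s → res h f ∈ par W s
  glue : ∀ (k : ℕ) {ι : Type u} (U : ι → Opens X) (f : ∀ i, F (U i)), (∀ i, f i ∈ wt (U i) k) →
    (∀ i j, res (inf_le_left : U i ⊓ U j ≤ U i) (f i) = res inf_le_right (f j)) →
    ∃! g : F (⨆ i, U i), g ∈ wt (⨆ i, U i) k ∧ ∀ i, res (le_iSup U i) g = f i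

attribute [instance] WeightedSheaf.ring WeightedSheaf.algebra WeightedSheaf.wtGraded
  WeightedSheaf.parGraded

section Manifold

variable {p : ℕ} {X : Type u} [TopologicalSpace X] [ChartedSpace (EuclideanSpace ℝ (Fin p)) X]

/-- Local coordinates `(x₁, …, xₚ; y₁, …, yₙ)` on an open set `U`. The `xₐ` are coordinates of the
underlying manifold, lifted to even functions of weight `0` by an embedding `σ` of the smooth
functions. The `yᵢ` have weights `0`, `1`, `2` and any parity, but are odd if the weight is `0`.
Every function is in exactly one way a polynomial in the `yᵢ`, with smooth coefficients and with
the odd `yᵢ` occurring to power at most `1`. -/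
structure Coordinates (𝓞 : WeightedSheaf.{u, v} X) (U : Opens X) where
  e : OpenPartialHomeomorph X (EuclideanSpace ℝ (Fin p))
  e_mem : e ∈ IsManifold.maximalAtlas (𝓡 p) ∞ X
  subset_source : (U : Set X) ⊆ e.source
  x : Fin p → C^∞⟮𝓡 p, U; ℝ⟯
  x_eq : ∀ (a : Fin p) (z : U), x a z = e z a
  σ : ∀ W : Opens X, W ≤ U → C^∞⟮𝓡 p, W; ℝ⟯ →ₐ[ℝ] 𝓞.F W
  σ_wt : ∀ W h f, σ W h f ∈ 𝓞.wt W 0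
  σ_par : ∀ W h f, σ W h f ∈ 𝓞.par W 0
  σ_res : ∀ (W W' : Opens X) (h : W ≤ U) (h' : W' ≤ W) (f : C^∞⟮𝓡 p, W; ℝ⟯),
    𝓞.res h' (σ W h f) =
      σ W' (h'.trans h) (ContMDiffMap.restrictRingHom (𝓡 p) 𝓘(ℝ, ℝ) ℝ h' f)
  n : ℕ
  weight : Fin n → ℕ
  weight_le : ∀ i, weight i ≤ 2
  parity : Fin n → ZMod 2
  parity_eq_one : ∀ i, weight i = 0 → parity i = 1
  y : Fin n → 𝓞.F U
  y_wt : ∀ i, y i ∈ 𝓞.wt U (weight i)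
  y_par : ∀ i, y i ∈ 𝓞.par U (parity i)
  polynomial : ∀ (W : Opens X) (h : W ≤ U), Function.Bijective
    fun c : {m : Fin n → ℕ // ∀ i, parity i = 1 → m i ≤ 1} →₀ C^∞⟮𝓡 p, W; ℝ⟯ =>
      c.sum fun m f => σ W h f * 𝓞.res h (List.ofFn fun i => y i ^ m.1 i).prod

/-- All the coordinates, as functions on `U`. -/
noncomputable def Coordinates.z {𝓞 : WeightedSheaf.{u, v} X} {U : Opens X} (c : Coordinates (p := p) 𝓞 U) :
    Fin p ⊕ Fin c.n → 𝓞.F U :=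
  Sum.elim (fun a => c.σ U le_rfl (c.x a)) c.y

variable (p X) in
/-- A symplectic 2-manifold with underlying smooth manifold `X` of dimension `p`: a supermanifold
with functions of non-negative weight, locally with coordinates of weights `0`, `1`, `2`, and with
a symplectic structure of weight `2`, given by its Poisson bracket: an even Poisson bracket of
weight `-2` which is non-degenerate, that is, has an invertible matrix in local coordinates. -/
structure SymplecticTwoManifold extends WeightedSheaf.{u, v} X where
  coordinates : ∀ x : X, ∃ U : Opens X, x ∈ U ∧ Nonempty (Coordinates (p := p) toWeightedSheaf U)
  br : ∀ U, F U →ₗ[ℝ] F U →ₗ[ℝ] F U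
  br_res : ∀ {U W : Opens X} (h : W ≤ U) (f g : F U), res h (br U f g) = br W (res h f) (res h g)
  poisson : ∀ U, IsWeightTwoPoisson (wt U) (par U) (br U)
  nondegenerate : ∀ (U : Opens X) (c : Coordinates (p := p) toWeightedSheaf U),
    IsUnit (Matrix.of fun a b => br U (c.z a) (c.z b))

namespace SymplecticTwoManifold

/-- The algebra of functions. -/
abbrev A (𝓜 : SymplecticTwoManifold.{u, v} p X) : Type v := 𝓜.F ⊤

/-- The functions of weight `k`. -/
abbrev Wt (𝓜 : SymplecticTwoManifold.{u, v} p X) (k : ℕ) : Submodule ℝ 𝓜.A := 𝓜.wt ⊤ k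

/-- The functions of parity `s`. -/
abbrev Par (𝓜 : SymplecticTwoManifold.{u, v} p X) (s : ZMod 2) : Submodule ℝ 𝓜.A := 𝓜.par ⊤ s

/-- The Poisson bracket of functions. -/
abbrev bracket (𝓜 : SymplecticTwoManifold.{u, v} p X) : 𝓜.A →ₗ[ℝ] 𝓜.A →ₗ[ℝ] 𝓜.A := 𝓜.br ⊤

/-- The projector onto functions of weights `0` and `1`. -/
noncomputable abbrev P (𝓜 : SymplecticTwoManifold.{u, v} p X) : 𝓜.A →ₗ[ℝ] 𝓜.A :=
  projP (𝓜.wt ⊤)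

end SymplecticTwoManifold

/-- The super vector space `Γ(E)` of sections of the pseudo-Euclidean vector bundle `E` that
corresponds to `𝓜`: a module over the functions of weight `0`, with the bilinear form `g` and with
the odd isomorphism `χ` onto the functions of weight `1`. -/
structure Sections (𝓜 : SymplecticTwoManifold.{u, v} p X) where
  V : Type w
  [addCommGroup : AddCommGroup V]
  [moduleReal : Module ℝ V]
  [module : Module (𝓜.Wt 0) V]
  par : ZMod 2 → Submodule ℝ V
  [decomposition : DirectSum.Decomposition par]
  χ : V ≃ₗ[ℝ] 𝓜.Wt 1
  χ_odd : ∀ (s : ZMod 2) (u : V), u ∈ par s → (χ u : 𝓜.A) ∈ 𝓜.Par (s + 1)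
  χ_smul : ∀ (s : ZMod 2) (f : 𝓜.Wt 0) (u : V), (f : 𝓜.A) ∈ 𝓜.Par s →
    (χ (f • u) : 𝓜.A) = sgn s • ((f : 𝓜.A) * χ u)
  g : V →ₗ[ℝ] V →ₗ[ℝ] 𝓜.Wt 0
  g_eq : ∀ (s : ZMod 2) (u v : V), u ∈ par s →
    (g u v : 𝓜.A) = sgn s • 𝓜.bracket (χ u) (χ v)

attribute [instance] Sections.addCommGroup Sections.moduleReal Sections.module
  Sections.decomposition

namespace Sections

variable {𝓜 : SymplecticTwoManifold.{u, v} p X}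

/-- The right-hand side
`(-1)^{(k-1)u₁ + (k-2)u₂ + ⋯ + uₖ₋₁} (P[⋯[D χ_{u₁}, χ_{u₂}], …, χ_{uₖ}]
  - [P[⋯[D χ_{u₁}, χ_{u₂}], …, χ_{uₖ₋₁}], χ_{uₖ}])`
of the derived bracket formula, for `k = m + 1` and homogeneous sections of parities `q`. -/
noncomputable def derivedFormula (E : Sections.{u, v, w} 𝓜) (D : 𝓜.A →ₗ[ℝ] 𝓜.A) {m : ℕ}
    (q : Fin (m + 1) → ZMod 2) (u : Fin (m + 1) → E.V) : 𝓜.A :=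
  sgn (∑ i : Fin (m + 1), ((m - (i : ℕ) : ℕ) : ZMod 2) * q i) •
    derivedForm (𝓜.wt ⊤) 𝓜.bracket D m (fun i => (E.χ (u i) : 𝓜.A))

/-- The higher derived Dorfman brackets generated by `D`: the multilinear operations `dₖ` on
`Γ(E)` with `χ(dₖ(u₁, …, uₖ))` given by the derived bracket formula. The sign is implemented by
applying the parity involution `k - i` times to the `i`th argument, and the inverse of `χ` is
applied to the component of weight `1`, which is everything where the formula defines a section.
There is no operation without arguments; it is set to `0`. -/
noncomputable def dorfman (E : Sections.{u, v, w} 𝓜) (D : 𝓜.A →ₗ[ℝ] 𝓜.A) :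
    (k : ℕ) → MultilinearMap ℝ (fun _ : Fin k => E.V) E.V
  | 0 => 0
  | m + 1 => (E.χ.symm.toLinearMap ∘ₗ toWeightOne (𝓜.wt ⊤)).compMultilinearMap
      ((derivedForm (𝓜.wt ⊤) 𝓜.bracket D m).compLinearMap fun i =>
        (𝓜.Wt 1).subtype ∘ₗ E.χ.toLinearMap ∘ₗ parityInvolution E.par ^ (m - (i : ℕ)))

/-- `B` is the Dorfman bracket generated by the function `Θ` of weight `3`. -/
def IsDorfmanBracket (E : Sections.{u, v, w} 𝓜) (Θ : 𝓜.A) (B : E.V → E.V → E.V) : Prop :=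
  Θ ∈ 𝓜.Wt 3 ∧ ∀ (s : ZMod 2) (u v : E.V), u ∈ E.par s →
    (E.χ (B u v) : 𝓜.A) = sgn s • 𝓜.bracket (𝓜.bracket Θ (E.χ u)) (E.χ v)

end Sections

end Manifold

end HigherDorfman

namespace HigherDorfman

universe u v w

/-! ### Signs -/

/-! Write aᵢ for the function of weight 1 of the ith section, pr₁ for the weight 1 component and θ_S
for the iterated bracket of θ with the aₛ, s ∈ S, in increasing order. Bracketing with aᵢ lowers the
weight by exactly one. Hence the difference in the derived bracket formula is the weight 1 component
of the nested bracket (`derivedForm_eq_proj`); for a single argument this needs Pθ = 0. So, up to a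
décalage sign, dₖ is pr₁ θ_{1…k}.

An unshuffle in Jₙ is a splitting of the indices below c into S and T, and its term becomes pr₁ of
[θ_S, pr₁ θ_{T,c}] bracketed with the remaining a's. The recursion `splitSum` decides for one index
after another whether it joins S or T. After the décalage (`χ_lodayJ_term`,
`splitSum_unshuffleExponent`) its signs are exactly those produced by the Leibniz rule for
bracketing with the next a.

Two facts then prove the identity. First, since P[f, a] - [Pf, a] = pr₁[f, a], the sum over c
collapses to ∑ ±[θ_S, Pθ_T] over all splittings (`sum_iteratedBr_splitSum`). Second, a bracket has
weight 1 only if the weights of its arguments add up to 3, so exactly one of them is below 2.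
Symmetrizing in S and T therefore doubles pr₁ of this sum into pr₁ ∑ ±[θ_S, θ_T]. By the Leibniz
rule the latter is pr₁ of the iterated bracket of [θ, θ], and [[θ, θ], a] = 2Q²a. -/

@[simp] theorem sgn_zero : sgn 0 = 1 := by simp [sgn]

@[simp] theorem sgn_one : sgn 1 = -1 := by simp [sgn, ZMod.val_one]

theorem sgn_add (s t : ZMod 2) : sgn (s + t) = sgn s * sgn t := by
  have h : ∀ s : ZMod 2, s = 0 ∨ s = 1 := by decide
  rcases h s with rfl | rfl <;> rcases h t with rfl | rfl <;>
    simp [show (1 : ZMod 2) + 1 = 0 from rfl]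

@[simp] theorem sgn_mul_self (s : ZMod 2) : sgn s * sgn s = 1 := by
  rw [← sgn_add, CharTwo.add_self_eq_zero, sgn_zero]

theorem sgn_natCast (n : ℕ) : sgn (n : ZMod 2) = (-1) ^ n := by
  induction n with
  | zero => simp
  | succ n ih => rw [Nat.cast_succ, sgn_add, ih, sgn_one, pow_succ]

theorem sgn_smul_smul {M : Type*} [AddCommGroup M] [Module ℝ M] (s t : ZMod 2) (x : M) :
    sgn s • sgn t • x = sgn (s + t) • x := by
  rw [smul_smul, sgn_add]

theorem sgn_sum {ι : Type*} (I : Finset ι) (f : ι → ZMod 2) :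
    sgn (∑ i ∈ I, f i) = ∏ i ∈ I, sgn (f i) := by
  classical
  induction I using Finset.induction_on with
  | empty => simp
  | insert i I hi ih => rw [Finset.sum_insert hi, Finset.prod_insert hi, sgn_add, ih]

/-! ### Signed sums over the splittings of an interval -/

section Split

variable {M N : Type*} [AddCommGroup M] [Module ℝ M] [AddCommGroup N] [Module ℝ N]

/-- The sum of `F S T` over all splittings of `0, …, c - 1` into two increasing lists `S` and `T`,
with the sign `(-1) ^ ζ T m` for each `m` in `S`, where `T` stands for its part below `m`. -/
def splitSum (ζ : List ℕ → ℕ → ZMod 2) : ℕ → (List ℕ → List ℕ → M) → M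
  | 0, F => F [] []
  | c + 1, F => splitSum ζ c (fun S T => F S (T ++ [c])) +
      splitSum ζ c (fun S T => sgn (ζ T c) • F (S ++ [c]) T)

/-- The permutation hypothesis makes lengths and parities of `S` and `T` add up to those of the
whole interval, which sign comparisons rely on. -/
theorem splitSum_congr (ζ : List ℕ → ℕ → ZMod 2) (c : ℕ) (F G : List ℕ → List ℕ → M)
    (h : ∀ S T, (S ++ T).Perm (List.range c) → F S T = G S T) :
    splitSum ζ c F = splitSum ζ c G := by
  induction c generalizing F G with
  | zero => exact h [] [] (by simp)
  | succ c ih =>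
    simp only [splitSum]
    congr 1
    · refine ih _ _ fun S T hST => h _ _ ?_
      rw [← List.append_assoc, List.range_succ]
      exact hST.append_right _
    · refine ih _ _ fun S T hST => ?_
      rw [h]
      rw [List.range_succ, List.append_assoc]
      exact (List.perm_append_comm.append_left S).trans
        (by rw [← List.append_assoc]; exact hST.append_right _)

theorem splitSum_add (ζ : List ℕ → ℕ → ZMod 2) (c : ℕ) (F G : List ℕ → List ℕ → M) :
    splitSum ζ c (fun S T => F S T + G S T) = splitSum ζ c F + splitSum ζ c G := by
  induction c generalizing F G with
  | zero => rfl
  | succ c ih =>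
    simp only [splitSum, smul_add, ih]
    abel

theorem map_splitSum (φ : M →ₗ[ℝ] N) (ζ : List ℕ → ℕ → ZMod 2) (c : ℕ)
    (F : List ℕ → List ℕ → M) :
    φ (splitSum ζ c F) = splitSum ζ c (fun S T => φ (F S T)) := by
  induction c generalizing F with
  | zero => rfl
  | succ c ih => simp only [splitSum, map_add, ih, map_smul]

theorem smul_splitSum (r : ℝ) (ζ : List ℕ → ℕ → ZMod 2) (c : ℕ) (F : List ℕ → List ℕ → M) :
    r • splitSum ζ c F = splitSum ζ c (fun S T => r • F S T) :=
  map_splitSum (LinearMap.lsmul ℝ M r) ζ c F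

/-- The exponent of the sign of exchanging a function of parity `p m` with the iterated bracket of
an odd function with functions of parities `p t`, `t ∈ T`. -/
def bracketExponent (p : ℕ → ZMod 2) (T : List ℕ) (m : ℕ) : ZMod 2 := (1 + (T.map p).sum) * p m

/-- The new sign is that of super skew-symmetry for functions of parities `1 + ∑ S` and `1 + ∑ T`.
Adding an element of parity `a` to `T` changes it by `(1 + ∑ S) * a`, which is what that element
costs on the other side. -/
theorem splitSum_swap (p : ℕ → ZMod 2) (c : ℕ) (F : List ℕ → List ℕ → M) :
    splitSum (bracketExponent p) c F = splitSum (bracketExponent p) c (fun S T =>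
      sgn ((1 + (S.map p).sum) * (1 + (T.map p).sum) + 1) • F T S) := by
  induction c generalizing F with
  | zero => simp [splitSum, show (1 : ZMod 2) + 1 = 0 from rfl]
  | succ c ih =>
    simp only [splitSum]
    rw [ih, add_comm, ih]
    congr 1 <;> congr 1 <;> ext S T <;>
      simp only [sgn_smul_smul, bracketExponent, List.map_append, List.sum_append,
        List.map_cons, List.map_nil, List.sum_cons, List.sum_nil] <;>
      congr 2 <;> generalize (S.map p).sum = s <;> generalize (T.map p).sum = t <;>
      generalize p c = a <;> revert s t a <;> decide

/-- `(k - 1) q₁ + (k - 2) q₂ + ⋯ + qₖ₋₁`. -/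
def decalage : List (ZMod 2) → ZMod 2
  | [] => 0
  | x :: L => (L.length : ZMod 2) * x + decalage L

theorem decalage_append (L L' : List (ZMod 2)) :
    decalage (L ++ L') = decalage L + (L'.length : ZMod 2) * L.sum + decalage L' := by
  induction L with
  | nil => simp [decalage]
  | cons x L ih =>
    simp only [List.cons_append, decalage, ih, List.length_append, List.sum_cons, Nat.cast_add]
    ring

theorem decalage_ofFn {m : ℕ} (q : Fin (m + 1) → ZMod 2) :
    decalage (List.ofFn q) = ∑ i : Fin (m + 1), ((m - (i : ℕ) : ℕ) : ZMod 2) * q i := by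
  induction m with
  | zero => simp [decalage]
  | succ m ih =>
    rw [List.ofFn_succ, decalage, ih, Fin.sum_univ_succ (n := m + 1)]
    simp

/-- The exponent of the sign, including that of the permutation, of moving an element of parity
`q m` past elements of parities `q t`, `t ∈ T`. -/
def unshuffleExponent (q : ℕ → ZMod 2) (T : List ℕ) (m : ℕ) : ZMod 2 :=
  (T.length : ZMod 2) + (T.map q).sum * q m

/-- Décalage: the odd map `χ` shifts each parity by one, turning the signs of unshuffles of sections
into Leibniz signs of functions. The correction is built up one index at a time, so the induction
reduces to a polynomial identity mod 2. -/
theorem splitSum_unshuffleExponent (q p : ℕ → ZMod 2) (hp : ∀ m, p m = q m + 1) (c : ℕ)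
    (F : List ℕ → List ℕ → M) :
    splitSum (unshuffleExponent q) c (fun S T => sgn (decalage ((List.range c).map q) +
      decalage (S.map q) + decalage (T.map q) + ((T.length : ZMod 2) + 1) * (S.map q).sum +
      (S.length : ZMod 2)) • F S T) = splitSum (bracketExponent p) c F := by
  have hsum : ∀ T : List ℕ, (T.map p).sum = (T.map q).sum + (T.length : ZMod 2) := by
    intro T
    induction T with
    | nil => simp
    | cons x T ih => simp only [List.map_cons, List.sum_cons, ih, hp, List.length_cons,
        Nat.cast_succ]; ring
  induction c generalizing F with
  | zero => simp [splitSum, decalage]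
  | succ c ih =>
    simp only [splitSum]
    rw [← ih, ← ih]
    congr 1 <;> refine splitSum_congr _ _ _ _ fun S T hST => ?_ <;>
    · have h1 : (((List.range c).map q).sum : ZMod 2) = (S.map q).sum + (T.map q).sum := by
        rw [← (hST.map q).sum_eq, List.map_append, List.sum_append]
      simp only [sgn_smul_smul, bracketExponent, unshuffleExponent, List.range_succ,
        List.map_append, List.sum_append, decalage_append, List.map_cons, List.map_nil,
        List.sum_cons, List.sum_nil, decalage, h1, hsum, hp, List.length_append, List.length_cons,
        List.length_nil, Nat.cast_add, Nat.cast_one, Nat.cast_zero]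
      congr 2
      rw [← sub_eq_zero]
      ring_nf
      reduce_mod_char

end Split

/-! ### Brackets of components -/

section Algebra

variable {A : Type v} [Ring A] [Algebra ℝ A]
  {wt : ℕ → Submodule ℝ A} [GradedAlgebra wt] {par : ZMod 2 → Submodule ℝ A}
  {br : A →ₗ[ℝ] A →ₗ[ℝ] A}

theorem proj_of_mem {k : ℕ} {f : A} (hf : f ∈ wt k) : GradedAlgebra.proj wt k f = f := by
  rw [GradedAlgebra.proj_apply, DirectSum.decompose_of_mem_same wt hf]

theorem proj_of_mem_ne {k l : ℕ} {f : A} (hf : f ∈ wt k) (h : k ≠ l) :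
    GradedAlgebra.proj wt l f = 0 := by
  rw [GradedAlgebra.proj_apply, DirectSum.decompose_of_mem_ne wt hf h]

theorem proj_mem (k : ℕ) (f : A) : GradedAlgebra.proj wt k f ∈ wt k := by
  rw [GradedAlgebra.proj_apply]
  exact SetLike.coe_mem _

theorem toWeightOne_coe (f : A) : (toWeightOne wt f : A) = GradedAlgebra.proj wt 1 f := by
  rw [GradedAlgebra.proj_apply]
  rfl

theorem projP_of_mem {k : ℕ} {f : A} (hf : f ∈ wt k) : projP wt f = if k < 2 then f else 0 := by
  rw [projP, LinearMap.add_apply]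
  rcases k with _ | _ | k
  · rw [proj_of_mem hf, proj_of_mem_ne hf (by omega)]; simp
  · rw [proj_of_mem hf, proj_of_mem_ne hf (by omega)]; simp
  · rw [proj_of_mem_ne hf (by omega), proj_of_mem_ne hf (by omega)]; simp

theorem proj_one_projP (f : A) :
    GradedAlgebra.proj wt 1 (projP wt f) = GradedAlgebra.proj wt 1 f := by
  rw [projP, LinearMap.add_apply, map_add, proj_of_mem_ne (proj_mem 0 f) (by omega),
    proj_of_mem (proj_mem 1 f), zero_add]

namespace IsWeightTwoPoisson

variable (h : IsWeightTwoPoisson wt par br)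
include h

theorem proj_br {a : A} (ha : a ∈ wt 1) (k : ℕ) (f : A) :
    GradedAlgebra.proj wt k (br f a) = br (GradedAlgebra.proj wt (k + 1) f) a := by
  induction f using DirectSum.Decomposition.inductionOn wt with
  | zero => simp
  | add f g hf hg => simp only [map_add, LinearMap.add_apply, hf, hg]
  | @homogeneous i f =>
    obtain ⟨f, hf⟩ := f
    rcases i with _ | i
    · rw [h.wt_neg 0 1 f a hf ha (by omega), proj_of_mem_ne hf (by omega)]
      simp
    · have hm := h.wt_mem (i + 1) 1 i f a hf ha rfl
      by_cases hik : i = k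
      · subst hik
        rw [proj_of_mem hm, proj_of_mem hf]
      · rw [proj_of_mem_ne hm hik, proj_of_mem_ne hf (by omega)]
        simp

/-- With fₖ the weight `k` component of `f`, the first term is [f₁, a] + [f₂, a] and the second is
[f₁, a], because [f₀, a] = 0. -/
theorem projP_br_sub {a : A} (ha : a ∈ wt 1) (f : A) :
    projP wt (br f a) - br (projP wt f) a = GradedAlgebra.proj wt 1 (br f a) := by
  simp only [projP, LinearMap.add_apply, map_add, h.proj_br ha,
    h.wt_neg 0 1 _ a (proj_mem 0 f) ha (by omega)]
  abel

theorem proj_one_br_projP {a : A} (ha : a ∈ wt 1) (f : A) :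
    GradedAlgebra.proj wt 1 (br (projP wt f) a) = 0 := by
  rw [h.proj_br ha, projP, LinearMap.add_apply, map_add,
    proj_of_mem_ne (proj_mem 0 f) (by omega), proj_of_mem_ne (proj_mem 1 f) (by omega)]
  simp

/-- Only components with weights adding up to 3 contribute, and then one weight is below 2 exactly
when the other is not. -/
theorem proj_one_br_projP_left (f g : A) :
    GradedAlgebra.proj wt 1 (br (projP wt f) g) =
      GradedAlgebra.proj wt 1 (br f (g - projP wt g)) := by
  induction f using DirectSum.Decomposition.inductionOn wt with
  | zero => simp
  | add f f' hf hf' => simp only [map_add, LinearMap.add_apply, hf, hf']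
  | @homogeneous i f =>
    induction g using DirectSum.Decomposition.inductionOn wt with
    | zero => simp
    | add g g' hg hg' =>
      rw [map_add, map_add, map_add, hg, hg', ← map_add, ← map_add]
      congr 2
      abel
    | @homogeneous j g =>
      obtain ⟨f, hf⟩ := f
      obtain ⟨g, hg⟩ := g
      simp only [projP_of_mem hf, projP_of_mem hg]
      by_cases hij : i + j = 3
      · have : i < 2 ↔ ¬ j < 2 := by omega
        by_cases hj : j < 2 <;> simp [this, hj]
      · have h0 : GradedAlgebra.proj wt 1 (br f g) = 0 := by
          by_cases hlt : i + j < 2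
          · rw [h.wt_neg i j f g hf hg hlt, map_zero]
          · exact proj_of_mem_ne (h.wt_mem i j (i + j - 2) f g hf hg (by omega)) (by omega)
        split_ifs <;> simp [h0]

end IsWeightTwoPoisson

/-- `[⋯[f, a₁], …, aₖ]`. -/
def iteratedBr (br : A →ₗ[ℝ] A →ₗ[ℝ] A) (f : A) (L : List A) : A :=
  L.foldl (fun x y => br x y) f

theorem iteratedBr_append (f : A) (L L' : List A) :
    iteratedBr br f (L ++ L') = iteratedBr br (iteratedBr br f L) L' := by
  simp [iteratedBr]

@[simp] theorem iteratedBr_nil (f : A) : iteratedBr br f [] = f := rfl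

@[simp] theorem iteratedBr_cons (f a : A) (L : List A) :
    iteratedBr br f (a :: L) = iteratedBr br (br f a) L := rfl

theorem iteratedBr_concat (f a : A) (L : List A) :
    iteratedBr br f (L ++ [a]) = br (iteratedBr br f L) a := by
  rw [iteratedBr_append, iteratedBr_cons, iteratedBr_nil]

/-- `iteratedBr` as a linear map in its first argument. -/
def iteratedBrₗ (br : A →ₗ[ℝ] A →ₗ[ℝ] A) : List A → A →ₗ[ℝ] A
  | [] => LinearMap.id
  | a :: L => iteratedBrₗ br L ∘ₗ br.flip a

theorem iteratedBrₗ_apply (f : A) (L : List A) : iteratedBrₗ br L f = iteratedBr br f L := by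
  induction L generalizing f with
  | nil => rfl
  | cons a L ih => simp [iteratedBrₗ, ih]

theorem iteratedBr_splitSum (ζ : List ℕ → ℕ → ZMod 2) (c : ℕ) (F : List ℕ → List ℕ → A)
    (L : List A) : iteratedBr br (splitSum ζ c F) L =
      splitSum ζ c fun S T => iteratedBr br (F S T) L := by
  simp only [← iteratedBrₗ_apply, map_splitSum]

theorem nested_eq_iteratedBr (D : A →ₗ[ℝ] A) (k : ℕ) (a : Fin (k + 1) → A) :
    nested br D k a = iteratedBr br (D (a 0)) (List.ofFn (Fin.tail a)) := by
  induction k with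
  | zero => simp [nested]
  | succ k ih =>
    rw [List.ofFn_succ', List.concat_eq_append, iteratedBr_concat]
    simp only [nested, MultilinearMap.uncurryRight_apply,
      LinearMap.compMultilinearMap_apply, ih]
    rfl

theorem nested_br_eq_iteratedBr (θ : A) (k : ℕ) (a : Fin (k + 1) → A) :
    nested br (br θ) k a = iteratedBr br θ (List.ofFn a) := by
  rw [nested_eq_iteratedBr, List.ofFn_succ, iteratedBr_cons]
  rfl

omit [GradedAlgebra wt] in
theorem iteratedBr_mem_par (h : IsWeightTwoPoisson wt par br) {s : ZMod 2} {f : A}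
    (hf : f ∈ par s) {ι : Type*} (a : ι → A) (p : ι → ZMod 2) (L : List ι)
    (ha : ∀ i ∈ L, a i ∈ par (p i)) :
    iteratedBr br f (L.map a) ∈ par (s + (L.map p).sum) := by
  induction L generalizing s f with
  | nil => simpa using hf
  | cons i L ih =>
    rw [List.map_cons, List.map_cons, List.sum_cons, iteratedBr_cons, ← add_assoc]
    exact ih (h.par_mem _ _ _ _ hf (ha i (by simp))) fun j hj => ha j (by simp [hj])

theorem proj_iteratedBr (h : IsWeightTwoPoisson wt par br) (f : A) (L : List A)
    (hL : ∀ a ∈ L, a ∈ wt 1) (k : ℕ) : GradedAlgebra.proj wt k (iteratedBr br f L) =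
      iteratedBr br (GradedAlgebra.proj wt (k + L.length) f) L := by
  induction L generalizing f with
  | nil => rfl
  | cons a L ih =>
    rw [iteratedBr_cons, iteratedBr_cons, ih _ fun b hb => hL b (by simp [hb]),
      h.proj_br (hL a (by simp)), List.length_cons, add_assoc]

/-- The subtracted term has weight 0, so it is invisible in weight 1, whatever `D` is. -/
theorem proj_one_derivedForm (h : IsWeightTwoPoisson wt par br) (D : A →ₗ[ℝ] A) (k : ℕ)
    (a : Fin (k + 1) → A) (ha : ∀ i, a i ∈ wt 1) :
    GradedAlgebra.proj wt 1 (derivedForm wt br D k a) =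
      GradedAlgebra.proj wt 1 (nested br D k a) := by
  cases k with
  | zero => simp only [derivedForm, LinearMap.compMultilinearMap_apply, proj_one_projP]
  | succ k =>
    simp only [derivedForm, sub_apply, MultilinearMap.uncurryRight_apply,
      LinearMap.compMultilinearMap_apply, LinearMap.comp_apply, map_sub, proj_one_projP,
      h.proj_one_br_projP (ha _), sub_zero]

/-- For two or more arguments the subtraction removes the weight 0 part by itself; for a single
argument `hD` does. -/
theorem derivedForm_eq_proj (h : IsWeightTwoPoisson wt par br) (D : A →ₗ[ℝ] A) (k : ℕ)
    (a : Fin (k + 1) → A) (ha : ∀ i, a i ∈ wt 1)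
    (hD : ∀ b ∈ wt 1, GradedAlgebra.proj wt 0 (D b) = 0) :
    derivedForm wt br D k a = GradedAlgebra.proj wt 1 (nested br D k a) := by
  cases k with
  | zero => simp [derivedForm, nested, projP, hD _ (ha _)]
  | succ k =>
    simp only [derivedForm, nested, sub_apply, MultilinearMap.uncurryRight_apply,
      LinearMap.compMultilinearMap_apply, LinearMap.comp_apply, h.projP_br_sub (ha _)]

/-! ### Bracketing with a function that has no components of weights 0 and 1 -/

section Generator

variable {θ : A} (h : IsWeightTwoPoisson wt par br) (hP : projP wt θ = 0)
include hP

theorem proj_one_of_projP : GradedAlgebra.proj wt 1 θ = 0 := by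
  rw [← proj_one_projP, hP, map_zero]

include h

/-- All components of `θ` have weight at least 2, so bracketing with `θ` never lowers the weight. -/
theorem proj_br_of_projP (k : ℕ) (f : A) (hf : ∀ i ≤ k, GradedAlgebra.proj wt i f = 0) :
    ∀ i ≤ k, GradedAlgebra.proj wt i (br θ f) = 0 := by
  have hwt : ∀ i f, f ∈ wt i → ∀ j < i, GradedAlgebra.proj wt j (br θ f) = 0 := by
    intro i f hf j hj
    have key : ∀ θ : A, GradedAlgebra.proj wt j (br θ f) =
        GradedAlgebra.proj wt j (br (projP wt θ) f) := by
      intro θ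
      induction θ using DirectSum.Decomposition.inductionOn wt with
      | zero => simp
      | add a b ha hb => simp only [map_add, LinearMap.add_apply, ha, hb]
      | @homogeneous l a =>
        obtain ⟨a, ha⟩ := a
        rw [projP_of_mem ha]
        split_ifs with hl
        · rfl
        · rw [proj_of_mem_ne (h.wt_mem l i (l + i - 2) a f ha hf (by omega)) (by omega)]
          simp
    rw [key, hP]
    simp
  intro i hi
  classical
  rw [← DirectSum.sum_support_decompose wt f, map_sum, map_sum]
  refine Finset.sum_eq_zero fun j _ => ?_
  by_cases hj : j ≤ k
  · have := hf j hj
    rw [GradedAlgebra.proj_apply] at this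
    rw [this]
    simp
  · exact hwt j _ (SetLike.coe_mem _) i (by omega)

theorem proj_zero_br {b : A} (hb : b ∈ wt 1) : GradedAlgebra.proj wt 0 (br θ b) = 0 := by
  rw [h.proj_br hb, proj_one_of_projP hP]
  simp

theorem proj_zero_br_br {b : A} (hb : b ∈ wt 1) :
    GradedAlgebra.proj wt 0 (br θ (br θ b)) = 0 := by
  refine proj_br_of_projP h hP 0 _ (fun i hi => ?_) 0 le_rfl
  obtain rfl : i = 0 := by omega
  exact proj_zero_br h hP hb

end Generator

/-! ### The quadratic identity -/

section Quadratic

variable (h : IsWeightTwoPoisson wt par br)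
include h

omit [GradedAlgebra wt] in
-- The Jacobi identity as a Leibniz rule for bracketing on the right with `b`; passing `b` across
-- `g` is the only source of a sign.
theorem br_br_right {r s t : ZMod 2} {f g b : A} (hf : f ∈ par r) (hg : g ∈ par s)
    (hb : b ∈ par t) : br (br f g) b = br f (br g b) + sgn (s * t) • br (br f b) g := by
  rw [h.jacobi r s f g b hf hg, h.super_skew s (r + t) g (br f b) hg (h.par_mem _ _ _ _ hf hb),
    smul_neg, sgn_smul_smul, show r * s + s * (r + t) = s * t by
      rw [← sub_eq_zero]; ring_nf; reduce_mod_char]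
  abel

variable {θ : A} (hθ : θ ∈ par 1) {a : ℕ → A} {p : ℕ → ZMod 2} (hp : ∀ i, a i ∈ par (p i))
include hθ

omit [GradedAlgebra wt] in
theorem br_br_self (b : A) :
    br (br θ θ) b = (2 : ℝ) • br θ (br θ b) := by
  have := h.jacobi 1 1 θ θ b hθ hθ
  rw [mul_one, sgn_one, neg_one_smul] at this
  rw [two_smul]
  nth_rewrite 1 [this]
  abel

include hp

omit [GradedAlgebra wt] in
-- By the Leibniz rule `a c` lands on the right or the left factor. The second sum is already the
-- branch of `splitSum` at `c + 1` in which `c` joins `S`. It is applied with `Φ` the identity and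
-- `Φ = P`.
theorem br_splitSum (Φ : A →ₗ[ℝ] A) (hΦ : ∀ s f, f ∈ par s → Φ f ∈ par s) (c : ℕ) :
    br (splitSum (bracketExponent p) c fun S T =>
      br (iteratedBr br θ (S.map a)) (Φ (iteratedBr br θ (T.map a)))) (a c) =
    splitSum (bracketExponent p) c (fun S T =>
      br (iteratedBr br θ (S.map a)) (br (Φ (iteratedBr br θ (T.map a))) (a c))) +
    splitSum (bracketExponent p) c (fun S T => sgn (bracketExponent p T c) •
      br (iteratedBr br θ ((S ++ [c]).map a)) (Φ (iteratedBr br θ (T.map a)))) := by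
  rw [← LinearMap.flip_apply, map_splitSum, ← splitSum_add]
  refine splitSum_congr _ _ _ _ fun S T _ => ?_
  rw [LinearMap.flip_apply, br_br_right h (iteratedBr_mem_par h hθ a p S fun i _ => hp i)
    (hΦ _ _ (iteratedBr_mem_par h hθ a p T fun i _ => hp i)) (hp c), List.map_append,
    List.map_cons, List.map_nil, iteratedBr_concat]
  rfl

omit [GradedAlgebra wt] in
theorem splitSum_br_iteratedBr (c : ℕ) :
    splitSum (bracketExponent p) c (fun S T =>
      br (iteratedBr br θ (S.map a)) (iteratedBr br θ (T.map a))) =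
    iteratedBr br (br θ θ) ((List.range c).map a) := by
  induction c with
  | zero => rfl
  | succ c ih =>
    rw [List.range_succ, List.map_append, List.map_cons, List.map_nil, iteratedBr_concat, ← ih]
    refine Eq.trans ?_ (br_splitSum h hθ hp LinearMap.id (fun _ _ hf => hf) c).symm
    simp only [splitSum, List.map_append, List.map_cons, List.map_nil, iteratedBr_concat,
      LinearMap.id_apply]

variable (hproj : ∀ (k : ℕ) (s : ZMod 2) (f : A), f ∈ par s → GradedAlgebra.proj wt k f ∈ par s)
  (ha : ∀ i, a i ∈ wt 1) (hP : projP wt θ = 0)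
include hproj ha hP

/-- Induction on `n`, starting from [θ, Pθ] = 0. Bracketing the sum for `n` with `a n` gives [Pθ_T,
aₙ] in the right factor, and the new summand `c = n` adds the pr₁[θ_T, aₙ] that completes it to
P[θ_T, aₙ]. -/
theorem sum_iteratedBr_splitSum (n : ℕ) :
    ∑ c ∈ Finset.range n, iteratedBr br (splitSum (bracketExponent p) c fun S T =>
      br (iteratedBr br θ (S.map a))
        (GradedAlgebra.proj wt 1 (iteratedBr br θ ((T ++ [c]).map a))))
      (((List.range n).drop (c + 1)).map a) =
    splitSum (bracketExponent p) n (fun S T =>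
      br (iteratedBr br θ (S.map a)) (projP wt (iteratedBr br θ (T.map a)))) := by
  induction n with
  | zero => simp [splitSum, hP]
  | succ n ih =>
    have hproj' : ∀ s f, f ∈ par s → projP wt f ∈ par s := fun s f hf =>
      add_mem (hproj 0 s f hf) (hproj 1 s f hf)
    rw [Finset.sum_range_succ, List.drop_of_length_le (by simp), List.map_nil, iteratedBr_nil]
    have hrec : ∀ c ∈ Finset.range n, ∀ x : A,
        iteratedBr br x (((List.range (n + 1)).drop (c + 1)).map a) =
          br (iteratedBr br x (((List.range n).drop (c + 1)).map a)) (a n) := by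
      intro c hc x
      have := Finset.mem_range.1 hc
      rw [List.range_succ, List.drop_append_of_le_length (by simp; omega), List.map_append,
        List.map_cons, List.map_nil, iteratedBr_concat]
    rw [Finset.sum_congr rfl fun c hc => hrec c hc _]
    rw [← LinearMap.sum_apply, ← map_sum, ih, br_splitSum h hθ hp (projP wt) hproj' n, splitSum,
      add_right_comm, ← splitSum_add]
    congr 1
    refine splitSum_congr _ _ _ _ fun S T _ => ?_
    rw [List.map_append, List.map_cons, List.map_nil, iteratedBr_concat, ← map_add,
      ← h.projP_br_sub (ha n)]
    congr 1
    abel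

theorem proj_one_sum_iteratedBr_splitSum (n : ℕ) :
    GradedAlgebra.proj wt 1
      (∑ c ∈ Finset.range (n + 1), iteratedBr br (splitSum (bracketExponent p) c fun S T =>
        br (iteratedBr br θ (S.map a))
          (GradedAlgebra.proj wt 1 (iteratedBr br θ ((T ++ [c]).map a))))
        (((List.range (n + 1)).drop (c + 1)).map a)) =
    GradedAlgebra.proj wt 1
      (iteratedBr br (br θ (br θ (a 0))) (((List.range (n + 1)).drop 1).map a)) := by
  have hproj' : ∀ s f, f ∈ par s → projP wt f ∈ par s := fun s f hf =>
    add_mem (hproj 0 s f hf) (hproj 1 s f hf)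
  have hpar : ∀ S : List ℕ, iteratedBr br θ (S.map a) ∈ par (1 + (S.map p).sum) := fun S =>
    iteratedBr_mem_par h hθ a p S fun i _ => hp i
  rw [sum_iteratedBr_splitSum h hθ hp hproj ha hP]
  have hsum := congrArg (GradedAlgebra.proj wt 1) (splitSum_br_iteratedBr h hθ hp (n + 1))
  rw [List.range_eq_range', List.range'_succ, List.map_cons, iteratedBr_cons,
    br_br_self h hθ, ← iteratedBrₗ_apply, map_smul, map_smul, iteratedBrₗ_apply] at hsum
  rw [List.range_eq_range', List.range'_succ, List.drop_one, List.tail_cons]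
  -- After doubling, one copy of the sum keeps the order of `S` and `T` and the other is swapped.
  -- Skew-symmetry cancels the sign of the swap, leaving [θ_S, Pθ_T] + [Pθ_S, θ_T], which agrees
  -- with [θ_S, θ_T] in weight 1.
  refine smul_right_injective A (two_ne_zero' ℝ) ?_
  beta_reduce
  rw [← hsum, two_smul]
  nth_rewrite 2 [splitSum_swap]
  simp only [map_splitSum]
  rw [← splitSum_add]
  refine splitSum_congr _ _ _ _ fun S T _ => ?_
  rw [sgn_add, sgn_one, mul_neg_one, neg_smul, map_neg, ← map_neg,
    h.super_skew _ _ _ _ (hpar T) (hproj' _ _ (hpar S)),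
    smul_neg, neg_neg, mul_comm (1 + (T.map p).sum), smul_smul, sgn_mul_self, one_smul,
    h.proj_one_br_projP_left, ← map_add, ← map_add, add_sub_cancel]

end Quadratic

end Algebra

/-! ### Sums over unshuffles -/

section Unshuffle

variable {M : Type*} [AddCommGroup M] [Module ℝ M]

/-- The exponent of the sign of the splitting into `S` and `T`. -/
def inversionExponent (q : ℕ → ZMod 2) (S T : Finset ℕ) : ZMod 2 :=
  ∑ s ∈ S, ∑ t ∈ T, if t < s then 1 + q s * q t else 0

theorem sort_insert_of_subset_range {c : ℕ} {S : Finset ℕ} (hS : S ⊆ Finset.range c) :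
    (insert c S).sort (· ≤ ·) = S.sort (· ≤ ·) ++ [c] := by
  have hlt : ∀ x ∈ S, x < c := fun x hx => Finset.mem_range.1 (hS hx)
  have hnd : (S.sort (· ≤ ·) ++ [c]).Nodup := by
    rw [List.nodup_append]
    refine ⟨Finset.sort_nodup _ _, by simp, ?_⟩
    simp only [Finset.mem_sort, List.mem_singleton]
    rintro x hx _ rfl
    exact (hlt x hx).ne
  have hset : insert c S = (S.sort (· ≤ ·) ++ [c]).toFinset := by
    ext x
    simp
  rw [hset, List.toFinset_sort _ hnd, List.pairwise_append]
  refine ⟨Finset.pairwise_sort _ _, by simp, ?_⟩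
  simp only [Finset.mem_sort, List.mem_singleton]
  rintro x hx _ rfl
  exact (hlt x hx).le

/-- Subsets are sorted by whether they contain the largest element `c`. In `S` it is inverted with
every element of `T`, which gives `unshuffleExponent`; in `T` it is inverted with nothing. -/
theorem sum_powerset_range (q : ℕ → ZMod 2) (c : ℕ) (F : List ℕ → List ℕ → M) :
    ∑ S ∈ (Finset.range c).powerset, sgn (inversionExponent q S (Finset.range c \ S)) •
      F (S.sort (· ≤ ·)) ((Finset.range c \ S).sort (· ≤ ·)) =
    splitSum (unshuffleExponent q) c F := by
  induction c generalizing F with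
  | zero => simp [splitSum, inversionExponent]
  | succ c ih =>
    rw [Finset.range_add_one, Finset.sum_powerset_insert (by simp), splitSum, ← ih, ← ih]
    congr 1 <;> refine Finset.sum_congr rfl fun S hS => ?_
    · rw [Finset.mem_powerset] at hS
      have hc : c ∉ S := fun hc => by simpa using hS hc
      rw [Finset.insert_sdiff_of_notMem _ hc, sort_insert_of_subset_range Finset.sdiff_subset]
      congr 2
      refine Finset.sum_congr rfl fun s hs => ?_
      have := Finset.mem_range.1 (hS hs)
      rw [Finset.sum_insert (by simp), if_neg (by omega), zero_add]
    · rw [Finset.mem_powerset] at hS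
      have hc : c ∉ S := fun hc => by simpa using hS hc
      have hdiff : insert c (Finset.range c) \ insert c S = Finset.range c \ S := by
        ext x
        simp only [Finset.mem_sdiff, Finset.mem_insert, Finset.mem_range]
        grind
      rw [hdiff, sort_insert_of_subset_range hS, sgn_smul_smul]
      congr 2
      rw [inversionExponent, Finset.sum_insert hc, add_comm]
      congr 1
      set T := Finset.range c \ S
      have hT : ∀ t ∈ T, t < c := fun t ht => Finset.mem_range.1 (Finset.sdiff_subset ht)
      have hsum : ((T.sort (· ≤ ·)).map q).sum = ∑ t ∈ T, q t := by
        rw [← List.sum_toFinset _ (Finset.sort_nodup _ _), Finset.sort_toFinset]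
      rw [unshuffleExponent, Finset.length_sort, hsum,
        Finset.sum_congr rfl fun t ht => if_pos (hT t ht), Finset.sum_add_distrib,
        Finset.sum_const, nsmul_one, Finset.sum_mul]
      exact congrArg _ (Finset.sum_congr rfl fun t _ => mul_comm _ _)

/-! ### Unshuffles as subsets of an initial segment -/

variable {c : ℕ}

/-- The values of a permutation of `0, …, c - 1`. -/
def permList (σ : Equiv.Perm (Fin c)) : List ℕ := List.ofFn fun x => (σ x : ℕ)

@[simp] theorem length_permList (σ : Equiv.Perm (Fin c)) : (permList σ).length = c := by
  simp [permList]

theorem nodup_permList (σ : Equiv.Perm (Fin c)) : (permList σ).Nodup :=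
  List.nodup_ofFn.2 (Fin.val_injective.comp σ.injective)

theorem permList_injective : Function.Injective (permList (c := c)) := by
  intro σ τ h
  ext x
  exact congrFun (List.ofFn_injective h) x

theorem permList_toFinset (σ : Equiv.Perm (Fin c)) :
    (permList σ).toFinset = Finset.range c := by
  ext x
  simp only [permList, List.mem_toFinset, List.mem_ofFn, Finset.mem_range]
  constructor
  · rintro ⟨y, rfl⟩
    exact (σ y).isLt
  · intro hx
    exact ⟨σ.symm ⟨x, hx⟩, by simp⟩

/-- The values of `σ` at positions below `a`. -/
def headSet (a : ℕ) (σ : Equiv.Perm (Fin c)) : Finset ℕ := ((permList σ).take a).toFinset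

theorem headSet_subset (a : ℕ) (σ : Equiv.Perm (Fin c)) : headSet a σ ⊆ Finset.range c := by
  rw [← permList_toFinset σ]
  exact fun x hx => List.mem_toFinset.2 (List.mem_of_mem_take (List.mem_toFinset.1 hx))

theorem range_sdiff_headSet (a : ℕ) (σ : Equiv.Perm (Fin c)) :
    Finset.range c \ headSet a σ = ((permList σ).drop a).toFinset := by
  have hnd := nodup_permList σ
  rw [← List.take_append_drop a (permList σ), List.nodup_append] at hnd
  rw [← permList_toFinset σ]
  nth_rewrite 1 [← List.take_append_drop a (permList σ)]
  ext x
  simp only [headSet, List.toFinset_append, Finset.mem_sdiff, Finset.mem_union, List.mem_toFinset]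
  have := hnd.2.2 x
  grind

theorem card_headSet {a : ℕ} (ha : a ≤ c) (σ : Equiv.Perm (Fin c)) : (headSet a σ).card = a := by
  rw [headSet, List.toFinset_card_of_nodup ((nodup_permList σ).sublist (List.take_sublist _ _))]
  simp [ha]

theorem headSet_eq_image (a : ℕ) (σ : Equiv.Perm (Fin c)) :
    headSet a σ = ({x : Fin c | (x : ℕ) < a} : Finset (Fin c)).image fun x => (σ x : ℕ) := by
  ext y
  simp only [headSet, permList, List.mem_toFinset, List.mem_take_iff_getElem, List.getElem_ofFn,
    Finset.mem_image, Finset.mem_filter, Finset.mem_univ, true_and, List.length_ofFn]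
  constructor
  · rintro ⟨i, hi, rfl⟩
    exact ⟨⟨i, by omega⟩, by simp; omega, rfl⟩
  · rintro ⟨x, hx, rfl⟩
    exact ⟨x, by omega, rfl⟩

theorem range_sdiff_headSet_eq_image (a : ℕ) (σ : Equiv.Perm (Fin c)) :
    Finset.range c \ headSet a σ =
      ({x : Fin c | a ≤ (x : ℕ)} : Finset (Fin c)).image fun x => (σ x : ℕ) := by
  ext y
  simp only [headSet_eq_image, Finset.mem_sdiff, Finset.mem_range, Finset.mem_image,
    Finset.mem_filter, Finset.mem_univ, true_and]
  constructor
  · rintro ⟨hy, h⟩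
    refine ⟨σ.symm ⟨y, hy⟩, ?_, by simp⟩
    by_contra hlt
    exact h ⟨σ.symm ⟨y, hy⟩, by omega, by simp⟩
  · rintro ⟨x, hx, rfl⟩
    refine ⟨(σ x).isLt, ?_⟩
    rintro ⟨x', hx', h⟩
    have := σ.injective (Fin.ext h)
    subst this
    omega

theorem sort_headSet {a : ℕ} {σ : Equiv.Perm (Fin c)} (hσ : σ ∈ unshuffles a c) :
    (headSet a σ).sort (· ≤ ·) = (permList σ).take a := by
  rw [headSet, List.toFinset_sort _ ((nodup_permList σ).sublist (List.take_sublist _ _)),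
    List.pairwise_iff_getElem]
  intro i j hi hj hij
  simp only [List.length_take, length_permList] at hi hj
  simp only [unshuffles, Finset.mem_filter, Finset.mem_univ, true_and] at hσ
  simp only [List.getElem_take, permList, List.getElem_ofFn]
  exact (hσ ⟨i, by omega⟩ ⟨j, by omega⟩ hij (Or.inl (by simp; omega))).le

theorem sort_range_sdiff_headSet {a : ℕ} {σ : Equiv.Perm (Fin c)} (hσ : σ ∈ unshuffles a c) :
    (Finset.range c \ headSet a σ).sort (· ≤ ·) = (permList σ).drop a := by
  rw [range_sdiff_headSet,
    List.toFinset_sort _ ((nodup_permList σ).sublist (List.drop_sublist _ _)),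
    List.pairwise_iff_getElem]
  intro i j hi hj hij
  simp only [List.length_drop, length_permList] at hi hj
  simp only [unshuffles, Finset.mem_filter, Finset.mem_univ, true_and] at hσ
  simp only [List.getElem_drop, permList, List.getElem_ofFn]
  exact (hσ ⟨a + i, by omega⟩ ⟨a + j, by omega⟩ (by simpa using hij) (Or.inr (by simp))).le

theorem exists_unshuffle {S : Finset ℕ} (hS : S ⊆ Finset.range c) :
    ∃ σ ∈ unshuffles S.card c, headSet S.card σ = S := by
  set K := S.sort (· ≤ ·) ++ (Finset.range c \ S).sort (· ≤ ·) with hK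
  have hlen : K.length = c := by
    have := Finset.card_le_card hS
    simp only [hK, List.length_append, Finset.length_sort, Finset.card_sdiff_of_subset hS]
    simp only [Finset.card_range] at *
    omega
  have hnd : K.Nodup := by
    rw [hK, List.nodup_append]
    refine ⟨Finset.sort_nodup _ _, Finset.sort_nodup _ _, ?_⟩
    simp only [Finset.mem_sort, Finset.mem_sdiff]
    rintro x hx y ⟨_, hy⟩ rfl
    exact hy hx
  have hlt : ∀ x ∈ K, x < c := by
    intro x hx
    simp only [hK, List.mem_append, Finset.mem_sort, Finset.mem_sdiff] at hx
    rcases hx with hx | hx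
    · exact Finset.mem_range.1 (hS hx)
    · exact Finset.mem_range.1 hx.1
  let f : Fin c → Fin c := fun x => ⟨K[(x : ℕ)]'(by omega), hlt _ (List.getElem_mem _)⟩
  have hf : Function.Injective f := by
    intro x y hxy
    exact Fin.ext ((hnd.getElem_inj_iff).1 (Fin.ext_iff.1 hxy))
  let σ : Equiv.Perm (Fin c) := Equiv.ofBijective f (Finite.injective_iff_bijective.1 hf)
  have hσ : ∀ x, (σ x : ℕ) = K[(x : ℕ)]'(by omega) := fun x => rfl
  have hσK : permList σ = K := by
    refine List.ext_getElem (by simp [hlen]) fun i h1 h2 => ?_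
    simp only [permList, List.getElem_ofFn, hσ]
  refine ⟨σ, ?_, ?_⟩
  · simp only [unshuffles, Finset.mem_filter, Finset.mem_univ, true_and]
    intro x y hxy h
    rw [Fin.lt_def, hσ, hσ]
    have hxy' : (x : ℕ) < y := hxy
    have hlt1 := List.pairwise_iff_getElem.1 (Finset.sortedLT_sort S).pairwise
    have hlt2 := List.pairwise_iff_getElem.1 (Finset.sortedLT_sort (Finset.range c \ S)).pairwise
    rcases h with h | h
    · simp only [hK]
      rw [List.getElem_append_left (by simp; omega), List.getElem_append_left (by simp; omega)]
      exact hlt1 _ _ _ _ hxy'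
    · simp only [hK]
      rw [List.getElem_append_right (by simp; omega), List.getElem_append_right (by simp; omega)]
      exact hlt2 _ _ _ _ (by simp; omega)
  · rw [headSet, hσK, hK, List.take_left' (by simp), Finset.sort_toFinset]

/-- An unshuffle increases on each of its two blocks, so every inversion pairs a head position with
a tail position. Both signs are products over inversions. -/
theorem sign_mul_koszulSign (q : ℕ → ZMod 2) {a : ℕ} {σ : Equiv.Perm (Fin c)}
    (hσ : σ ∈ unshuffles a c) :
    ((Equiv.Perm.sign σ : ℤ) : ℝ) * koszulSign (fun x : Fin c => q x) σ =
      sgn (inversionExponent q (headSet a σ) (Finset.range c \ headSet a σ)) := by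
  have hinj : Function.Injective fun x : Fin c => (σ x : ℕ) :=
    Fin.val_injective.comp σ.injective
  have hsign : ((Equiv.Perm.sign σ : ℤ) : ℝ) =
      ∏ x : Fin c, ∏ y : Fin c, if x < y ∧ σ y < σ x then -1 else 1 := by
    rw [Equiv.Perm.sign_eq_prod_prod_Ioi]
    push_cast
    refine Finset.prod_congr rfl fun x _ => ?_
    rw [← Finset.prod_subset (Finset.subset_univ (Finset.Ioi x))]
    · refine Finset.prod_congr rfl fun y hy => ?_
      have hxy := Finset.mem_Ioi.1 hy
      have hne : σ x ≠ σ y := fun h => hxy.ne (σ.injective h)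
      rcases lt_or_gt_of_ne hne with h | h
      · simp [h, h.not_gt]
      · simp [h, h.not_gt, hxy]
    · intro y _ hy
      rw [if_neg fun h => hy (Finset.mem_Ioi.2 h.1)]
  rw [hsign, koszulSign, range_sdiff_headSet_eq_image, headSet_eq_image, inversionExponent,
    Finset.sum_image (hinj.injOn), sgn_sum, ← Finset.prod_mul_distrib, Finset.prod_filter]
  refine Finset.prod_congr rfl fun x _ => ?_
  rw [Finset.sum_image (hinj.injOn), sgn_sum, Finset.prod_filter, ← Finset.prod_mul_distrib]
  simp only [unshuffles, Finset.mem_filter, Finset.mem_univ, true_and] at hσ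
  split_ifs with hx
  · refine Finset.prod_congr rfl fun y _ => ?_
    by_cases hy : a ≤ (y : ℕ)
    · have hxy : x < y := Fin.lt_def.2 (by omega)
      by_cases h : σ y < σ x
      · simp [hy, hxy, h, sgn_add]
      · simp [hy, h]
    · rw [if_neg, if_neg, if_neg hy, mul_one]
      all_goals
        rintro ⟨h1, h2⟩
        exact (hσ x y h1 (Or.inl (by omega))).not_gt h2
  · refine Finset.prod_eq_one fun y _ => ?_
    rw [if_neg, if_neg, mul_one]
    all_goals
      rintro ⟨h1, h2⟩
      exact (hσ x y h1 (Or.inr (by omega))).not_gt h2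

/-- An unshuffle is determined by the set of values in its first block; letting `b` vary gives every
subset once. -/
theorem sum_unshuffles (q : ℕ → ZMod 2) (c : ℕ) (F : List ℕ → List ℕ → M) :
    ∑ b ∈ Finset.range (c + 1), ∑ σ ∈ unshuffles (c - b) c,
      (((Equiv.Perm.sign σ : ℤ) : ℝ) * koszulSign (fun x : Fin c => q x) σ) •
        F ((permList σ).take (c - b)) ((permList σ).drop (c - b)) =
    splitSum (unshuffleExponent q) c F := by
  rw [← sum_powerset_range, Finset.sum_sigma']
  refine Finset.sum_bij (fun x _ => headSet (c - x.1) x.2) ?_ ?_ ?_ ?_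
  · rintro ⟨b, σ⟩ _
    exact Finset.mem_powerset.2 (headSet_subset _ _)
  · rintro ⟨b, σ⟩ h ⟨b', σ'⟩ h' heq
    simp only [Finset.mem_sigma, Finset.mem_range] at h h' heq
    have hb : b = b' := by
      have := congrArg Finset.card heq
      rw [card_headSet (by omega), card_headSet (by omega)] at this
      omega
    subst hb
    have hσ : permList σ = permList σ' := by
      rw [← List.take_append_drop (c - b) (permList σ), ← sort_headSet h.2,
        ← sort_range_sdiff_headSet h.2, heq, sort_headSet h'.2, sort_range_sdiff_headSet h'.2,
        List.take_append_drop]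
    rw [permList_injective hσ]
  · intro S hS
    rw [Finset.mem_powerset] at hS
    obtain ⟨σ, hσ, hσS⟩ := exists_unshuffle hS
    have hcard := Finset.card_le_card hS
    rw [Finset.card_range] at hcard
    refine ⟨⟨c - S.card, σ⟩, ?_, ?_⟩
    · simp only [Finset.mem_sigma, Finset.mem_range]
      exact ⟨by omega, by rwa [Nat.sub_sub_self hcard]⟩
    · simp only [Nat.sub_sub_self hcard, hσS]
  · rintro ⟨b, σ⟩ h
    simp only [Finset.mem_sigma] at h
    rw [sign_mul_koszulSign q h.2, sort_headSet h.2, sort_range_sdiff_headSet h.2]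

end Unshuffle

/-! ### Operations on lists -/

section Lists

variable {V : Type w} [AddCommGroup V] [Module ℝ V]

theorem apply_ofFn (l : (k : ℕ) → MultilinearMap ℝ (fun _ : Fin k => V) V) {n : ℕ}
    (v : Fin n → V) : apply l (List.ofFn v) = l n v := by
  -- With the list as a variable, `n` can be replaced by its length without transport between the
  -- types `Fin`.
  have key : ∀ (L : List V) (n : ℕ) (v : Fin n → V), L = List.ofFn v → apply l L = l n v := by
    intro L n v hL
    have hn : n = L.length := by rw [hL, List.length_ofFn]
    subst hn
    have : L.get = v := List.ofFn_injective (by rw [List.ofFn_get, ← hL])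
    rw [apply, this]
  exact key _ _ _ rfl

theorem parityInvolution_of_mem (par : ZMod 2 → Submodule ℝ V) [DirectSum.Decomposition par]
    {s : ZMod 2} {v : V} (hv : v ∈ par s) : parityInvolution par v = sgn s • v := by
  rw [parityInvolution, LinearMap.sum_apply, Finset.sum_eq_single s]
  · simp only [LinearMap.smul_apply, LinearMap.comp_apply, Submodule.subtype_apply]
    exact congrArg _ (DirectSum.decompose_of_mem_same par hv)
  · intro t _ hts
    simp only [LinearMap.smul_apply, LinearMap.comp_apply, Submodule.subtype_apply]
    exact (congrArg _ (DirectSum.decompose_of_mem_ne par hv hts.symm)).trans (smul_zero _)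
  · simp

theorem parityInvolution_pow_of_mem (par : ZMod 2 → Submodule ℝ V) [DirectSum.Decomposition par]
    {s : ZMod 2} {v : V} (hv : v ∈ par s) (k : ℕ) :
    (parityInvolution par ^ k) v = sgn ((k : ZMod 2) * s) • v := by
  induction k with
  | zero => simp
  | succ k ih =>
    rw [pow_succ, Module.End.mul_apply, parityInvolution_of_mem par hv, map_smul, ih,
      sgn_smul_smul]
    congr 2
    push_cast
    ring

/-- The values of `f` on an initial segment, extended by zero. -/
def extendZero {α : Type*} [Zero α] {n : ℕ} (f : Fin n → α) (m : ℕ) : α :=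
  if h : m < n then f ⟨m, h⟩ else 0

theorem extendZero_coe {α : Type*} [Zero α] {n : ℕ} (f : Fin n → α) (x : Fin n) :
    extendZero f x = f x := by
  simp [extendZero]

theorem map_range_extendZero {α : Type*} [Zero α] {n : ℕ} (f : Fin n → α) :
    (List.range n).map (extendZero f) = List.ofFn f := by
  refine List.ext_getElem (by simp) fun i h1 h2 => ?_
  simp only [List.length_map, List.length_range] at h1
  simp [extendZero, h1]

theorem map_permList_extendZero {α : Type*} [Zero α] {n : ℕ} (f : Fin n → α) (c : Fin n)
    (σ : Equiv.Perm (Fin c)) :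
    List.ofFn (fun x : Fin c => f ((σ x).castLE c.isLt.le)) =
      (permList σ).map (extendZero f) := by
  rw [permList, List.map_ofFn]
  congr 1
  ext x
  exact (extendZero_coe f _).symm

theorem lodayJ_eq_sum_splitSum (l : (k : ℕ) → MultilinearMap ℝ (fun _ : Fin k => V) V) {n : ℕ}
    (q : Fin n → ZMod 2) (v : Fin n → V) :
    lodayJ l q v = ∑ c ∈ Finset.range n, splitSum (unshuffleExponent (extendZero q)) c
      fun S T => sgn (((n - c : ℕ) : ZMod 2) * T.length +
        ((T.length : ZMod 2) + 1) * (S.map (extendZero q)).sum) •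
        apply l (S.map (extendZero v) ++ [apply l ((T ++ [c]).map (extendZero v))] ++
          ((List.range n).drop (c + 1)).map (extendZero v)) := by
  rw [Finset.sum_range, lodayJ]
  refine Finset.sum_congr rfl fun c _ => ?_
  rw [← sum_unshuffles]
  refine Finset.sum_congr rfl fun b hb => Finset.sum_congr rfl fun σ _ => ?_
  have hb' := Finset.mem_range.1 hb
  have hlen : ((permList σ).drop (c - b)).length = b := by
    simp only [List.length_drop, length_permList]
    omega
  have hq : (fun x : Fin c => q (x.castLE c.isLt.le)) = fun x : Fin c => extendZero q x := by
    ext x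
    exact (extendZero_coe q _).symm
  have hsum : (∑ x : Fin c, if (x : ℕ) < (c : ℕ) - b then q ((σ x).castLE c.isLt.le) else 0) =
      (((permList σ).take (c - b)).map (extendZero q)).sum := by
    rw [List.map_take, ← map_permList_extendZero, List.sum_take_ofFn, Finset.sum_filter]
  rw [smul_smul, map_permList_extendZero, hsum, hq, hlen, ← List.map_take, ← List.map_drop,
    List.map_append, List.map_cons, List.map_nil, extendZero_coe, ← map_range_extendZero v,
    ← List.map_drop, sgn_add, ← Nat.cast_mul, sgn_natCast, Nat.cast_succ]
  congr 1
  ring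

end Lists

/-! ### Derived brackets of sections -/

section Manifold

variable {p : ℕ} {X : Type u} [TopologicalSpace X] [ChartedSpace (EuclideanSpace ℝ (Fin p)) X]
  {𝓜 : SymplecticTwoManifold.{u, v} p X}

namespace Sections

variable (E : Sections.{u, v, w} 𝓜)

/-- The component of `u` of the other parity has an image under `χ` of both parities, hence zero,
and `χ` is injective. -/
theorem mem_par_of_χ {s : ZMod 2} {u : E.V} (hu : (E.χ u : 𝓜.A) ∈ 𝓜.Par (s + 1)) :
    u ∈ E.par s := by
  have hsplit : u = (DirectSum.decompose E.par u s : E.V) +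
      (DirectSum.decompose E.par u (s + 1) : E.V) := by
    have huniv : ∀ s : ZMod 2, Finset.univ = {s, s + 1} := by decide
    classical
    have hu := DirectSum.sum_support_decompose E.par u
    rw [Finset.sum_subset (Finset.subset_univ _) (fun i _ hi => by
      rw [DFinsupp.notMem_support_iff.1 hi]; rfl), huniv s, Finset.sum_pair (by simp)] at hu
    exact hu.symm
  set x : E.V := (DirectSum.decompose E.par u s : E.V)
  set y : E.V := (DirectSum.decompose E.par u (s + 1) : E.V)
  have hx : x ∈ E.par s := SetLike.coe_mem _
  have hy : y ∈ E.par (s + 1) := SetLike.coe_mem _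
  have hχy : (E.χ y : 𝓜.A) ∈ 𝓜.Par (s + 1) := by
    have : (E.χ y : 𝓜.A) = E.χ u - E.χ x := by
      rw [hsplit, map_add]
      simp
    rw [this]
    exact sub_mem hu (E.χ_odd s x hx)
  have h0 : (E.χ y : 𝓜.A) = 0 := by
    rw [← DirectSum.decompose_of_mem_same (𝓜.par ⊤) hχy,
      DirectSum.decompose_of_mem_ne (𝓜.par ⊤) (E.χ_odd _ y hy) (by simp)]
  have : y = 0 := E.χ.map_eq_zero_iff.1 (Subtype.ext h0)
  rw [hsplit, this, add_zero]
  exact hx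

theorem χ_dorfman (D : 𝓜.A →ₗ[ℝ] 𝓜.A) (m : ℕ) (u : Fin (m + 1) → E.V) :
    (E.χ (E.dorfman D (m + 1) u) : 𝓜.A) = GradedAlgebra.proj (𝓜.wt ⊤) 1
      (nested 𝓜.bracket D m fun i =>
        (E.χ ((parityInvolution E.par ^ (m - (i : ℕ))) (u i)) : 𝓜.A)) := by
  rw [← proj_one_derivedForm (𝓜.poisson ⊤) D m _ fun i => SetLike.coe_mem _, ← toWeightOne_coe]
  simp [dorfman]

theorem χ_dorfman_of_mem (D : 𝓜.A →ₗ[ℝ] 𝓜.A) (m : ℕ) (q : Fin (m + 1) → ZMod 2)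
    (u : Fin (m + 1) → E.V) (hu : ∀ i, u i ∈ E.par (q i)) :
    (E.χ (E.dorfman D (m + 1) u) : 𝓜.A) =
      sgn (∑ i : Fin (m + 1), ((m - (i : ℕ) : ℕ) : ZMod 2) * q i) •
        GradedAlgebra.proj (𝓜.wt ⊤) 1
          (nested 𝓜.bracket D m fun i => (E.χ (u i) : 𝓜.A)) := by
  rw [χ_dorfman, sgn_sum, ← map_smul, ← MultilinearMap.map_smul_univ]
  congr 2
  ext i
  rw [parityInvolution_pow_of_mem E.par (hu i), map_smul]
  rfl

theorem χ_dorfman_eq_derivedFormula (D : 𝓜.A →ₗ[ℝ] 𝓜.A)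
    (hD : ∀ b ∈ 𝓜.Wt 1, GradedAlgebra.proj (𝓜.wt ⊤) 0 (D b) = 0) (m : ℕ)
    (q : Fin (m + 1) → ZMod 2) (u : Fin (m + 1) → E.V) (hu : ∀ i, u i ∈ E.par (q i)) :
    (E.χ (E.dorfman D (m + 1) u) : 𝓜.A) = E.derivedFormula D q u := by
  rw [χ_dorfman_of_mem E D m q u hu, derivedFormula,
    derivedForm_eq_proj (𝓜.poisson ⊤) D m _ (fun i => SetLike.coe_mem _) hD]

variable {θ : 𝓜.A}

/-- Each section is listed with its parity, so that the output of an inner bracket can be inserted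
as an argument of an outer one. -/
theorem χ_apply_dorfman (θ : 𝓜.A) (L : List (E.V × ZMod 2)) (hne : L ≠ [])
    (hL : ∀ x ∈ L, x.1 ∈ E.par x.2) :
    (E.χ (apply (E.dorfman (𝓜.bracket θ)) (L.map Prod.fst)) : 𝓜.A) =
      sgn (decalage (L.map Prod.snd)) • GradedAlgebra.proj (𝓜.wt ⊤) 1
        (iteratedBr 𝓜.bracket θ (L.map fun x => (E.χ x.1 : 𝓜.A))) := by
  obtain ⟨m, f, rfl⟩ : ∃ (m : ℕ) (f : Fin (m + 1) → E.V × ZMod 2), L = List.ofFn f := by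
    cases L with
    | nil => exact absurd rfl hne
    | cons x L => exact ⟨L.length, (x :: L).get, (List.ofFn_get _).symm⟩
  rw [List.map_ofFn, List.map_ofFn, List.map_ofFn, apply_ofFn,
    χ_dorfman_of_mem E _ m (Prod.snd ∘ f) (Prod.fst ∘ f) fun i => hL _ (List.mem_ofFn.2 ⟨i, rfl⟩),
    decalage_ofFn, nested_br_eq_iteratedBr]
  rfl

theorem apply_dorfman_mem_par (hθ : θ ∈ 𝓜.Par 1) (L : List (E.V × ZMod 2)) (hne : L ≠ [])
    (hL : ∀ x ∈ L, x.1 ∈ E.par x.2) :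
    apply (E.dorfman (𝓜.bracket θ)) (L.map Prod.fst) ∈
      E.par ((L.length : ZMod 2) + (L.map Prod.snd).sum) := by
  refine E.mem_par_of_χ ?_
  rw [χ_apply_dorfman E θ L hne hL]
  refine Submodule.smul_mem _ _ ((𝓜.super ⊤).proj_mem_par _ _ _ ?_)
  have := iteratedBr_mem_par (𝓜.poisson ⊤) hθ (fun x : E.V × ZMod 2 => (E.χ x.1 : 𝓜.A))
    (fun x => x.2 + 1) L fun x hx => E.χ_odd _ _ (hL x hx)
  convert this using 2
  rw [List.sum_map_add, List.map_const', List.sum_replicate, nsmul_one]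
  ring

theorem dorfman_mem_par (hθ : θ ∈ 𝓜.Par 1) (k : ℕ) (hk : 1 ≤ k) (q : Fin k → ZMod 2)
    (u : Fin k → E.V) (hu : ∀ i, u i ∈ E.par (q i)) :
    E.dorfman (𝓜.bracket θ) k u ∈ E.par ((k : ZMod 2) + ∑ i, q i) := by
  have := E.apply_dorfman_mem_par hθ (List.ofFn fun i => (u i, q i))
    (by rw [Ne, List.ofFn_eq_nil_iff]; omega) (by
      intro x hx
      obtain ⟨i, rfl⟩ := List.mem_ofFn.1 hx
      exact hu i)
  rw [List.map_ofFn, List.map_ofFn, apply_ofFn, List.length_ofFn, List.sum_ofFn] at this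
  exact this

/-- The total sign is factored into the correction absorbed by `splitSum_unshuffleExponent` and a
sign depending only on `n` and all the parities, which can leave the sums over `c`, `S` and `T`. -/
theorem χ_lodayJ_term (hθ : θ ∈ 𝓜.Par 1) (q : ℕ → ZMod 2) (u : ℕ → E.V)
    (hu : ∀ i, u i ∈ E.par (q i)) {n c : ℕ} (hc : c < n) (S T : List ℕ)
    (hST : (S ++ T).Perm (List.range c)) :
    sgn (((n - c : ℕ) : ZMod 2) * T.length + ((T.length : ZMod 2) + 1) * (S.map q).sum) •
      (E.χ (apply (E.dorfman (𝓜.bracket θ)) (S.map u ++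
        [apply (E.dorfman (𝓜.bracket θ)) ((T ++ [c]).map u)] ++
          ((List.range n).drop (c + 1)).map u)) : 𝓜.A) =
    sgn (decalage ((List.range c).map q) + decalage (S.map q) + decalage (T.map q) +
        ((T.length : ZMod 2) + 1) * (S.map q).sum + (S.length : ZMod 2)) •
      sgn ((n : ZMod 2) + 1 + decalage ((List.range n).map q)) •
        GradedAlgebra.proj (𝓜.wt ⊤) 1 (iteratedBr 𝓜.bracket
          (𝓜.bracket (iteratedBr 𝓜.bracket θ (S.map fun i => (E.χ (u i) : 𝓜.A)))
            (GradedAlgebra.proj (𝓜.wt ⊤) 1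
              (iteratedBr 𝓜.bracket θ ((T ++ [c]).map fun i => (E.χ (u i) : 𝓜.A)))))
          (((List.range n).drop (c + 1)).map fun i => (E.χ (u i) : 𝓜.A))) := by
  set R := (List.range n).drop (c + 1) with hR
  set x := apply (E.dorfman (𝓜.bracket θ)) ((T ++ [c]).map u) with hx
  let pair : ℕ → E.V × ZMod 2 := fun i => (u i, q i)
  have hpair : ∀ L : List ℕ, ∀ y ∈ L.map pair, y.1 ∈ E.par y.2 := by
    intro L y hy
    obtain ⟨i, _, rfl⟩ := List.mem_map.1 hy
    exact hu i
  have hfst : ∀ L : List ℕ, (L.map pair).map Prod.fst = L.map u := fun L => by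
    rw [List.map_map]; rfl
  have hsnd : ∀ L : List ℕ, (L.map pair).map Prod.snd = L.map q := fun L => by
    rw [List.map_map]; rfl
  have hχ : ∀ L : List ℕ, (L.map pair).map (fun y => (E.χ y.1 : 𝓜.A)) =
      L.map fun i => (E.χ (u i) : 𝓜.A) := fun L => by
    rw [List.map_map]; rfl
  have hTne : (T ++ [c]).map pair ≠ [] := by simp
  have hxpar := E.apply_dorfman_mem_par hθ _ hTne (hpair _)
  have hxχ := E.χ_apply_dorfman θ _ hTne (hpair _)
  rw [hfst, ← hx, hsnd, List.length_map] at hxpar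
  rw [hfst, ← hx, hsnd, hχ] at hxχ
  set t := ((T ++ [c]).length : ZMod 2) + ((T ++ [c]).map q).sum with ht
  have hout := E.χ_apply_dorfman θ (S.map pair ++ [(x, t)] ++ R.map pair) (by simp) (by
    intro y hy
    rw [List.mem_append, List.mem_append, List.mem_singleton] at hy
    rcases hy with (hy | rfl) | hy
    · exact hpair _ _ hy
    · exact hxpar
    · exact hpair _ _ hy)
  simp only [List.map_append, List.map_cons, List.map_nil, hfst, hsnd, hχ] at hout hxχ ⊢
  rw [hout, hxχ, iteratedBr_append, iteratedBr_concat, map_smul, ← iteratedBrₗ_apply, map_smul,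
    map_smul, iteratedBrₗ_apply, sgn_smul_smul, sgn_smul_smul, sgn_smul_smul]
  congr 2
  have hrange : List.range n = List.range c ++ [c] ++ R := by
    have := List.take_append_drop (c + 1) (List.range n)
    rw [List.take_range, min_eq_left hc] at this
    rw [← List.range_succ, hR, this]
  have hRlen : R.length = n - c - 1 := by
    rw [hR, List.length_drop, List.length_range]
    omega
  have hsum : ((List.range c).map q).sum = (S.map q).sum + (T.map q).sum := by
    rw [← (hST.map q).sum_eq, List.map_append, List.sum_append]
  have hlen : (S.length : ZMod 2) + T.length = c := by
    have := hST.length_eq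
    rw [List.length_append, List.length_range] at this
    rw [← Nat.cast_add, this]
  obtain ⟨k, rfl⟩ : ∃ k, n = c + k + 1 := ⟨n - c - 1, by omega⟩
  rw [show c + k + 1 - c - 1 = k by omega] at hRlen
  rw [hrange, ht, show c + k + 1 - c = k + 1 by omega]
  simp only [List.map_append, List.map_cons, List.map_nil, decalage_append, decalage,
    List.sum_append, List.sum_cons, List.sum_nil, List.length_append, List.length_map,
    List.length_cons, List.length_nil, hRlen, hsum, Nat.cast_add, Nat.cast_one, Nat.cast_zero,
    ← hlen]
  rw [← sub_eq_zero]
  ring_nf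
  reduce_mod_char

theorem lodayJ_dorfman (hθ : θ ∈ 𝓜.Par 1) (hP : 𝓜.P θ = 0) (m : ℕ) (q : Fin (m + 1) → ZMod 2)
    (u : Fin (m + 1) → E.V) (hu : ∀ i, u i ∈ E.par (q i)) :
    lodayJ (E.dorfman (𝓜.bracket θ)) q u = (-1 : ℝ) ^ (m + 1 + 1) •
      E.dorfman (𝓜.bracket θ ∘ₗ 𝓜.bracket θ) (m + 1) u := by
  -- The default value 0 is homogeneous of every parity, so the extended sequence is homogeneous
  -- throughout.
  have hu' : ∀ i, extendZero u i ∈ E.par (extendZero q i) := by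
    intro i
    unfold extendZero
    split_ifs
    · exact hu _
    · exact zero_mem _
  have hpar : ∀ i, (E.χ (extendZero u i) : 𝓜.A) ∈ 𝓜.Par (extendZero q i + 1) := fun i =>
    E.χ_odd _ _ (hu' i)
  apply E.χ.injective
  apply Subtype.ext
  let χ' : E.V →ₗ[ℝ] 𝓜.A := (𝓜.Wt 1).subtype ∘ₗ E.χ.toLinearMap
  change χ' _ = χ' _
  rw [lodayJ_eq_sum_splitSum, map_sum]
  have hterm : ∀ c ∈ Finset.range (m + 1), _ := fun c hc =>
    (map_splitSum χ' (unshuffleExponent (extendZero q)) c _).trans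
      ((splitSum_congr _ _ _ _ fun S T hST => (map_smul χ' _ _).trans
        (E.χ_lodayJ_term hθ (extendZero q) (extendZero u) hu' (Finset.mem_range.1 hc) S T
          hST)).trans (splitSum_unshuffleExponent _ (fun i => extendZero q i + 1) (fun _ => rfl)
            c _))
  rw [Finset.sum_congr rfl hterm]
  have key := congrArg (sgn (((m + 1 : ℕ) : ZMod 2) + 1 +
    decalage ((List.range (m + 1)).map (extendZero q))) • ·)
    (proj_one_sum_iteratedBr_splitSum (𝓜.poisson ⊤) hθ hpar (𝓜.super ⊤).proj_mem_par
      (fun i => SetLike.coe_mem _) hP m)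
  simp only [map_sum, Finset.smul_sum, iteratedBr_splitSum, map_splitSum, smul_splitSum] at key
  refine key.trans ?_
  have hu0 : extendZero u 0 = u 0 := extendZero_coe u 0
  have htail : ((List.range (m + 1)).drop 1).map (fun i => (E.χ (extendZero u i) : 𝓜.A)) =
      List.ofFn (Fin.tail fun i => (E.χ (u i) : 𝓜.A)) := by
    have := congrArg (List.map fun x => (E.χ x : 𝓜.A)) (map_range_extendZero u)
    rw [List.map_map, List.map_ofFn, List.ofFn_succ] at this
    rw [List.map_drop]
    exact congrArg (List.drop 1) this
  -- The remaining sign is the décalage sign of the bracket generated by Q² times `sgn (n + 1)`,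
  -- with `n = m + 1`.
  rw [hu0, htail, map_range_extendZero, map_smul, decalage_ofFn]
  refine Eq.trans ?_ (congrArg _ (E.χ_dorfman_of_mem _ m q u hu).symm)
  rw [nested_eq_iteratedBr, smul_smul, ← sgn_natCast, ← sgn_add, Nat.cast_succ (m + 1)]
  rfl

/-- Two brackets with functions of weight 1 lower the weight by two, so the weight 1 part comes from
the weight 3 component of `θ`. The involution acts only on the first argument, so the second need
not be homogeneous. -/
theorem isDorfmanBracket (θ : 𝓜.A) :
    E.IsDorfmanBracket (GradedAlgebra.proj (𝓜.wt ⊤) 3 θ)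
      fun u v => E.dorfman (𝓜.bracket θ) 2 ![u, v] := by
  refine ⟨proj_mem 3 θ, fun s u v hu => ?_⟩
  rw [χ_dorfman, nested_br_eq_iteratedBr, proj_iteratedBr (𝓜.poisson ⊤) _ _ (by
    intro a ha
    obtain ⟨i, rfl⟩ := List.mem_ofFn.1 ha
    exact SetLike.coe_mem _)]
  simp [List.ofFn_succ, parityInvolution_of_mem E.par hu]

end Sections
end Manifold
end HigherDorfman

/-! ### The theorem on higher Dorfman brackets -/

theorem mainTheorem1 {p : ℕ} {X : Type*} [TopologicalSpace X]
    [ChartedSpace (EuclideanSpace ℝ (Fin p)) X] [IsManifold (𝓡 p) ∞ X]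
    [T2Space X] [SecondCountableTopology X]
    (𝓜 : HigherDorfman.SymplecticTwoManifold p X) (E : HigherDorfman.Sections 𝓜)
    (θ : 𝓜.A) (hθ_odd : θ ∈ 𝓜.Par 1) (hθ_P : 𝓜.P θ = 0)
    (Q : 𝓜.A →ₗ[ℝ] 𝓜.A) (hQ : Q = 𝓜.bracket θ) :
    -- the brackets generated by `Q` and by `Q²` are given by the derived bracket formula
    (∀ (m : ℕ) (q : Fin (m + 1) → ZMod 2) (u : Fin (m + 1) → E.V), (∀ i, u i ∈ E.par (q i)) →
      (E.χ (E.dorfman Q (m + 1) u) : 𝓜.A) = E.derivedFormula Q q u ∧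
      (E.χ (E.dorfman (Q ∘ₗ Q) (m + 1) u) : 𝓜.A) = E.derivedFormula (Q ∘ₗ Q) q u) ∧
    -- `Jₙ` is, up to sign, the `n`th bracket generated by `Q²`
    (∀ (n : ℕ), 1 ≤ n → ∀ (q : Fin n → ZMod 2) (u : Fin n → E.V), (∀ i, u i ∈ E.par (q i)) →
      HigherDorfman.lodayJ (E.dorfman Q) q u =
        (-1 : ℝ) ^ (n + 1) • E.dorfman (Q ∘ₗ Q) n u) ∧
    -- if `Q² = 0`, the brackets form a homotopy Loday algebra
    (Q ∘ₗ Q = 0 → HigherDorfman.IsHomotopyLoday E.par (E.dorfman Q)) ∧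
    -- the binary bracket is the Dorfman bracket of the component of weight 3 of `θ`
    E.IsDorfmanBracket (GradedAlgebra.proj (𝓜.wt ⊤) 3 θ) (fun u v => E.dorfman Q 2 ![u, v]) := by
  subst hQ
  have hJ : ∀ (n : ℕ), 1 ≤ n → ∀ (q : Fin n → ZMod 2) (u : Fin n → E.V),
      (∀ i, u i ∈ E.par (q i)) → HigherDorfman.lodayJ (E.dorfman (𝓜.bracket θ)) q u =
        (-1 : ℝ) ^ (n + 1) • E.dorfman (𝓜.bracket θ ∘ₗ 𝓜.bracket θ) n u := by
    intro n hn q u hu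
    obtain ⟨m, rfl⟩ : ∃ m, n = m + 1 := ⟨n - 1, by omega⟩
    exact E.lodayJ_dorfman hθ_odd hθ_P m q u hu
  refine ⟨fun m q u hu => ⟨?_, ?_⟩, hJ, fun hQ2 => ⟨?_, ?_⟩, E.isDorfmanBracket θ⟩
  · exact E.χ_dorfman_eq_derivedFormula _
      (fun b hb => HigherDorfman.proj_zero_br (𝓜.poisson ⊤) hθ_P hb) m q u hu
  · exact E.χ_dorfman_eq_derivedFormula _
      (fun b hb => HigherDorfman.proj_zero_br_br (𝓜.poisson ⊤) hθ_P hb) m q u hu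
  · exact fun k hk q u hu => E.dorfman_mem_par hθ_odd k hk q u hu
  · intro n hn q u hu
    obtain ⟨m, rfl⟩ : ∃ m, n = m + 1 := ⟨n - 1, by omega⟩
    have h0 : E.dorfman (𝓜.bracket θ ∘ₗ 𝓜.bracket θ) (m + 1) u = 0 := by
      apply E.χ.injective
      apply Subtype.ext
      rw [E.χ_dorfman_of_mem _ m q u hu, HigherDorfman.nested_eq_iteratedBr, hQ2,
        LinearMap.zero_apply, ← HigherDorfman.iteratedBrₗ_apply]
      simp
    rw [hJ _ hn q u hu, h0, smul_zero]
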